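/- A Minkowski norm on a finite-dimensional real vector space $X$ is a function $\|\cdot\|:X\to[0,\infty)$ that is $C^2$ outside the origin, vanishes only at the origin, satisfies $\|\lambda v\|=\lambda\|v\|$ for all $\lambda>0$ and $\|v+w\|\le\|v\|+\|w\|$, and is such that the Hessian of $v\mapsto\|v\|^2$ is positive definite at every $v\ne0$. A ($C^2$) Finsler metric on a finite-dimensional real affine space $V$ is a continuous function $F:TV\to[0,\infty)$ that is $C^2$ outside the zero section and whose restriction to each tangent space is a Minkowski norm. The pair $(V,F)$ is a Minkowski–Randers space if $F$ is a $C^2$ Finsler metric that can be written as $F=F_0+\beta$, where $F_0$ is a translation-invariant Finsler metric on $V$ and $\beta$ is a differential $1$-form of class $C^2$ on $V$. Theorem. Let $V$ be a real affine space of finite dimension $n\ge 3$ provided with a Finsler metric $F$. Then $(V,F)$ is a Minkowski–Randers space if and only if every affine hyperplane $U\subset V$, provided with the induced metric $F|_{TU}$, is a Minkowski–Randers space. -/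

import Mathlib

/-- A Minkowski norm on a finite-dimensional real vector space `E` (possibly asymmetric).  The
norm carried by `E` only serves to speak of derivatives; all choices of it are equivalent. -/
structure IsMinkowskiNorm {E : Type*} [NormedAddCommGroup E] [NormedSpace ℝ E]
    (N : E → ℝ) : Prop where
  nonneg : ∀ v, 0 ≤ N v
  contDiffOn : ContDiffOn ℝ 2 N {v | v ≠ 0}
  eq_zero_iff : ∀ v, N v = 0 ↔ v = 0
  pos_homogeneous : ∀ (c : ℝ) (v : E), 0 < c → N (c • v) = c * N v
  triangle : ∀ v w, N (v + w) ≤ N v + N w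
  /-- The Hessian of the square is positive definite away from the origin. -/
  hessian_pos : ∀ v, v ≠ 0 → ∀ w, w ≠ 0 →
    0 < fderiv ℝ (fderiv ℝ (fun u => N u ^ 2)) v w w

/-- A `C²` Finsler metric on the affine space `P` with direction space `E`.  The tangent bundle
is `P × E`, and `F x v` is the value at the vector `v` tangent at `x`.  Regularity is expressed
in the charts `w ↦ w +ᵥ o` of `P`, where `o` is any choice of origin. -/
structure IsFinslerMetric {E P : Type*} [NormedAddCommGroup E] [NormedSpace ℝ E]
    [AddTorsor E P] (F : P → E → ℝ) : Prop where
  continuous : ∀ o : P, Continuous (fun p : E × E => F (p.1 +ᵥ o) p.2)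
  contDiffOn : ∀ o : P, ContDiffOn ℝ 2 (fun p : E × E => F (p.1 +ᵥ o) p.2) {p | p.2 ≠ 0}
  isMinkowskiNorm : ∀ x : P, IsMinkowskiNorm (F x)

/-- Invariance of a function on the tangent bundle under all translations of `P`. -/
def IsTranslationInvariant {E P : Type*} [NormedAddCommGroup E] [NormedSpace ℝ E]
    [AddTorsor E P] (F : P → E → ℝ) : Prop :=
  ∀ (u : E) (x : P) (v : E), F (u +ᵥ x) v = F x v

/-- A field of covectors on `P` that is a differential `1`-form of class `C²`. -/
def IsC2OneForm {E P : Type*} [NormedAddCommGroup E] [NormedSpace ℝ E]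
    [AddTorsor E P] (β : P → (E →L[ℝ] ℝ)) : Prop :=
  ∀ o : P, ContDiff ℝ 2 (fun w : E => β (w +ᵥ o))

/-- `(P, F)` is a Minkowski–Randers space: `F` is a `C²` Finsler metric that is the sum of a
translation-invariant Finsler metric and a `1`-form. -/
def IsMinkowskiRanders {E P : Type*} [NormedAddCommGroup E] [NormedSpace ℝ E]
    [AddTorsor E P] (F : P → E → ℝ) : Prop :=
  IsFinslerMetric F ∧
    ∃ (F₀ : P → E → ℝ) (β : P → (E →L[ℝ] ℝ)),
      IsFinslerMetric F₀ ∧ IsTranslationInvariant F₀ ∧ IsC2OneForm β ∧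
        ∀ x v, F x v = F₀ x v + β x v

/-- The metric induced on an affine subspace `U`, whose direction space is `U.direction`. -/
def inducedMetric {E P : Type*} [NormedAddCommGroup E] [NormedSpace ℝ E]
    [AddTorsor E P] (F : P → E → ℝ) (U : AffineSubspace ℝ P) : U → U.direction → ℝ :=
  fun x v => F (x : P) (v : E)

/-- Affine hyperplanes: non-empty affine subspaces of codimension one. -/
def IsAffineHyperplane {E P : Type*} [NormedAddCommGroup E] [NormedSpace ℝ E]
    [AddTorsor E P] (U : AffineSubspace ℝ P) : Prop :=
  (U : Set P).Nonempty ∧ Module.finrank ℝ U.direction + 1 = Module.finrank ℝ E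

open Filter Topology

/-! ### Restriction to affine subspaces -/

section Restriction

variable {E E' : Type*} [NormedAddCommGroup E] [NormedSpace ℝ E]
  [NormedAddCommGroup E'] [NormedSpace ℝ E']

/-! Minkowski–Randers structure restricts to subspaces. Conversely, it suffices that D = F_x - F_y
is linear for all points x, y: then F is F_o plus the 1-form F_x - F_o. As n ≥ 3, a hyperplane
through x and y can contain any further direction, so D is linear on each plane containing x - y
(`sub_linear_on_plane`). To add arbitrary v and w, an auxiliary point z with y - z = w is used:
comparing the three differences shows that D(v + w) - D(v) is unchanged along v + ℝw
(`IsFinslerMetric.sub_map_add`). Homogeneity and continuity then identify it with D(w)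
(`map_add_of_defect_invariant`). -/

theorem fderiv_fderiv_comp_continuousLinearMap {g : E → ℝ} {s : Set E} (hs : IsOpen s)
    (hg : ContDiffOn ℝ 2 g s) (L : E' →L[ℝ] E) {v : E'} (hv : L v ∈ s) (w w' : E') :
    fderiv ℝ (fderiv ℝ (fun u => g (L u))) v w w' =
      fderiv ℝ (fderiv ℝ g) (L v) (L w) (L w') := by
  have hev : fderiv ℝ (fun u => g (L u)) =ᶠ[𝓝 v] fun u => (fderiv ℝ g (L u)).comp L := by
    filter_upwards [L.continuous.continuousAt.preimage_mem_nhds (hs.mem_nhds hv)] with u hu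
    have h1 : DifferentiableAt ℝ g (L u) :=
      (hg.contDiffAt (hs.mem_nhds hu)).differentiableAt (by norm_num)
    exact (h1.hasFDerivAt.comp u L.hasFDerivAt).fderiv
  have h2 : DifferentiableAt ℝ (fderiv ℝ g) (L v) :=
    ((hg.contDiffAt (hs.mem_nhds hv)).fderiv_right (m := 1) (by norm_num)).differentiableAt
      (by norm_num)
  have h3 : HasFDerivAt (fun u => fderiv ℝ g (L u)) ((fderiv ℝ (fderiv ℝ g) (L v)).comp L) v :=
    h2.hasFDerivAt.comp v L.hasFDerivAt
  rw [hev.fderiv_eq, (h3.clm_comp (hasFDerivAt_const L v)).fderiv]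
  simp

theorem IsMinkowskiNorm.comp_injective {N : E → ℝ} (hN : IsMinkowskiNorm N) (L : E' →L[ℝ] E)
    (hL : Function.Injective L) : IsMinkowskiNorm (fun v => N (L v)) where
  nonneg v := hN.nonneg _
  contDiffOn := hN.contDiffOn.comp L.contDiff.contDiffOn fun v (hv : v ≠ 0) =>
    (map_ne_zero_iff L hL).2 hv
  eq_zero_iff v := by rw [hN.eq_zero_iff, map_eq_zero_iff L hL]
  pos_homogeneous c v hc := by rw [map_smul, hN.pos_homogeneous c _ hc]
  triangle v w := by rw [map_add]; exact hN.triangle _ _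
  hessian_pos v hv w hw := by
    rw [fderiv_fderiv_comp_continuousLinearMap (g := fun u => N u ^ 2) isOpen_ne
      (hN.contDiffOn.pow 2) L ((map_ne_zero_iff L hL).2 hv)]
    exact hN.hessian_pos _ ((map_ne_zero_iff L hL).2 hv) _ ((map_ne_zero_iff L hL).2 hw)

variable {P : Type*} [AddTorsor E P]

theorem IsFinslerMetric.induced {F : P → E → ℝ} (hF : IsFinslerMetric F)
    (U : AffineSubspace ℝ P) [Nonempty U] : IsFinslerMetric (inducedMetric F U) where
  continuous o := (hF.continuous (o : P)).comp
    (f := fun p : U.direction × U.direction => ((p.1 : E), (p.2 : E))) (by fun_prop)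
  contDiffOn o := by
    refine (hF.contDiffOn (o : P)).comp
      (f := fun p : U.direction × U.direction => ((p.1 : E), (p.2 : E))) ?_ ?_
    · exact (U.direction.subtypeL.prodMap U.direction.subtypeL).contDiff.contDiffOn
    · intro p hp
      simpa using hp
  isMinkowskiNorm x :=
    (hF.isMinkowskiNorm (x : P)).comp_injective U.direction.subtypeL Subtype.val_injective

theorem IsMinkowskiRanders.induced {F : P → E → ℝ} (hF : IsMinkowskiRanders F)
    (U : AffineSubspace ℝ P) [Nonempty U] : IsMinkowskiRanders (inducedMetric F U) := by
  obtain ⟨hF, F₀, β, hF₀, hinv, hβ, hsum⟩ := hF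
  refine ⟨hF.induced U, inducedMetric F₀ U,
    fun x => (β x).comp U.direction.subtypeL, hF₀.induced U, ?_, ?_, ?_⟩
  · exact fun u x v => hinv u x v
  · intro o
    exact ((hβ (o : P)).comp U.direction.subtypeL.contDiff).clm_comp contDiff_const
  · exact fun x v => hsum x v

end Restriction

/-! ### Linearity of the differences F_x - F_y -/

section Linearity

variable {E P : Type*} [NormedAddCommGroup E] [NormedSpace ℝ E] [AddTorsor E P]

/-- Two vectors span at most a plane, so in dimension at least 3 a nonzero functional kills both;
its kernel directs the hyperplane. -/
theorem exists_isAffineHyperplane_mem_of_three_le_finrank [FiniteDimensional ℝ E]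
    (hE : 3 ≤ Module.finrank ℝ E) (x : P) (u v : E) :
    ∃ U : AffineSubspace ℝ P, IsAffineHyperplane U ∧ x ∈ U ∧ u ∈ U.direction ∧ v ∈ U.direction := by
  have hlt : Submodule.span ℝ {u, v} < ⊤ := by
    refine Submodule.lt_top_of_finrank_lt_finrank ?_
    have : Module.finrank ℝ (Submodule.span ℝ ({u, v} : Set E)) ≤ 2 := by
      classical
      refine (finrank_span_le_card ({u, v} : Set E)).trans ?_
      simpa using Finset.card_le_two (a := u) (b := v)
    omega
  obtain ⟨f, hf, hle⟩ := Submodule.exists_le_ker_of_lt_top _ hlt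
  have hmem : ∀ w ∈ ({u, v} : Set E), w ∈ LinearMap.ker f := fun w hw =>
    hle (Submodule.subset_span hw)
  refine ⟨AffineSubspace.mk' x (LinearMap.ker f), ⟨⟨x, AffineSubspace.self_mem_mk' _ _⟩, ?_⟩,
    AffineSubspace.self_mem_mk' _ _, ?_, ?_⟩
  · rw [AffineSubspace.direction_mk']
    exact Module.Dual.finrank_ker_add_one_of_ne_zero hf
  · rw [AffineSubspace.direction_mk']
    exact hmem u (by simp)
  · rw [AffineSubspace.direction_mk']
    exact hmem v (by simp)

/-- If all hyperplanes are Minkowski–Randers, the difference of the norms at two points is linear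
on every plane containing the direction joining the points. -/
theorem sub_linear_on_plane [FiniteDimensional ℝ E] (hE : 3 ≤ Module.finrank ℝ E)
    {F : P → E → ℝ}
    (hU : ∀ (U : AffineSubspace ℝ P) [Nonempty U], IsAffineHyperplane U →
      IsMinkowskiRanders (inducedMetric F U)) (x y : P) (v : E) :
    ∃ p q : ℝ, ∀ a b : ℝ, F x (a • (x -ᵥ y) + b • v) - F y (a • (x -ᵥ y) + b • v) =
      a * p + b * q := by
  obtain ⟨U, hHyp, hx, hu, hv⟩ :=
    exists_isAffineHyperplane_mem_of_three_le_finrank hE x (x -ᵥ y) v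
  have hy : y ∈ U := by
    have h := AffineSubspace.vadd_mem_of_mem_direction (U.direction.neg_mem hu) hx
    simpa using h
  have : Nonempty U := ⟨⟨x, hx⟩⟩
  obtain ⟨-, F₀, β, -, hinv, -, hsum⟩ := hU U hHyp
  let x' : U := ⟨x, hx⟩
  let y' : U := ⟨y, hy⟩
  have key : ∀ w : U.direction, F x w - F y w = (β x' - β y') w := by
    intro w
    have h1 : F x w = F₀ x' w + β x' w := hsum x' w
    have h2 : F y w = F₀ y' w + β y' w := hsum y' w
    have h3 := hinv (x' -ᵥ y') y' w
    rw [vsub_vadd] at h3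
    rw [h1, h2, h3, sub_apply]
    ring
  refine ⟨(β x' - β y') ⟨_, hu⟩, (β x' - β y') ⟨v, hv⟩, fun a b => ?_⟩
  have h := key (a • ⟨x -ᵥ y, hu⟩ + b • ⟨v, hv⟩)
  rw [map_add, map_smul, map_smul] at h
  exact h

/-- The additivity defect of a positively homogeneous function vanishes if it does not
change when its second argument is added to the first. -/
theorem map_add_of_defect_invariant {D : E → ℝ} (hD : Continuous D)
    (hhom : ∀ (c : ℝ) (v : E), 0 < c → D (c • v) = c * D v) (v w : E)
    (hinv : ∀ b : ℝ, D (v + b • w + w) - D (v + b • w) = D (v + w) - D v) :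
    D (v + w) = D v + D w := by
  have hstep : ∀ k : ℕ, D (v + (k : ℝ) • w) = D v + k * (D (v + w) - D v) := by
    intro k
    induction k with
    | zero => simp
    | succ k ih =>
      have h := hinv k
      have e : v + ((k + 1 : ℕ) : ℝ) • w = v + (k : ℝ) • w + w := by
        push_cast; rw [add_smul, one_smul, add_assoc]
      rw [e]
      push_cast
      linarith
  have h0 : Tendsto (fun k : ℕ => (1 : ℝ) / ((k : ℝ) + 1)) atTop (𝓝 0) :=
    tendsto_one_div_add_atTop_nhds_zero_nat
  have hl : Tendsto (fun k : ℕ => D (((1 : ℝ) / ((k : ℝ) + 1)) • v + w)) atTop (𝓝 (D w)) := by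
    have h : Continuous fun t : ℝ => D (t • v + w) := by fun_prop
    simpa [Function.comp_def] using (h.tendsto 0).comp h0
  have hr : Tendsto (fun k : ℕ => ((1 : ℝ) / ((k : ℝ) + 1)) * D v + (D (v + w) - D v)) atTop
      (𝓝 (D (v + w) - D v)) := by
    simpa using (h0.mul_const (D v)).add_const (D (v + w) - D v)
  -- This is `hstep` at k + 1, rescaled by 1/(k + 1); as k → ∞ the left side tends to D w.
  have heq : ∀ k : ℕ, D (((1 : ℝ) / ((k : ℝ) + 1)) • v + w) =
      ((1 : ℝ) / ((k : ℝ) + 1)) * D v + (D (v + w) - D v) := by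
    intro k
    have hk : (0 : ℝ) < (k : ℝ) + 1 := by positivity
    have e : ((1 : ℝ) / ((k : ℝ) + 1)) • v + w =
        ((1 : ℝ) / ((k : ℝ) + 1)) • (v + ((k + 1 : ℕ) : ℝ) • w) := by
      rw [smul_add, smul_smul]
      push_cast
      rw [one_div, inv_mul_cancel₀ hk.ne', one_smul]
    rw [e, hhom _ _ (by positivity), hstep]
    push_cast
    field_simp
  have := tendsto_nhds_unique (hl.congr heq) hr
  linarith

theorem IsFinslerMetric.continuous_apply {F : P → E → ℝ} (hF : IsFinslerMetric F) (x : P) :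
    Continuous (F x) := by
  have h := (hF.continuous x).comp (f := fun v : E => ((0 : E), v)) (by fun_prop)
  simpa [Function.comp_def] using h

theorem IsFinslerMetric.sub_map_add [FiniteDimensional ℝ E] (hE : 3 ≤ Module.finrank ℝ E)
    {F : P → E → ℝ} (hF : IsFinslerMetric F)
    (hU : ∀ (U : AffineSubspace ℝ P) [Nonempty U], IsAffineHyperplane U →
      IsMinkowskiRanders (inducedMetric F U)) (x y : P) (v w : E) :
    F x (v + w) - F y (v + w) = (F x v - F y v) + (F x w - F y w) := by
  refine map_add_of_defect_invariant (D := fun v => F x v - F y v)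
    ((hF.continuous_apply x).sub (hF.continuous_apply y)) ?_ v w ?_
  · intro c v hc
    simp only [(hF.isMinkowskiNorm _).pos_homogeneous c v hc]
    ring
  intro b
  have hplane := sub_linear_on_plane hE hU
  obtain ⟨u, hu⟩ : ∃ u, u = x -ᵥ y := ⟨_, rfl⟩
  obtain ⟨z, hz⟩ : ∃ z : P, z = -w +ᵥ y := ⟨_, rfl⟩
  have hyz : y -ᵥ z = w := by rw [hz, vsub_vadd_eq_vsub_sub]; simp
  have hxz : x -ᵥ z = u + w := by rw [← vsub_add_vsub_cancel x y z, hyz, hu]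
  -- along `x - y`, `y - z` and `x - z` the differences are affine with fixed slopes
  have hslope : ∀ (x y : P) (v : E), F x (v + (x -ᵥ y)) - F y (v + (x -ᵥ y)) =
      F x v - F y v + (F x (x -ᵥ y) - F y (x -ᵥ y)) := by
    intro x y v
    obtain ⟨p, q, h⟩ := hplane x y v
    have h1 := h 1 1
    have h2 := h 0 1
    have h3 := h 1 0
    simp only [one_smul, zero_smul, zero_add, add_zero] at h1 h2 h3
    rw [add_comm v, h1, h2, h3]
    ring
  have hw : ∀ (v : E) (b : ℝ), F y (v + b • w) - F z (v + b • w) =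
      F y v - F z v + b * (F y w - F z w) := by
    intro v b
    obtain ⟨p, q, h⟩ := hplane y z v
    rw [hyz] at h
    have h1 := h b 1
    have h2 := h 0 1
    have h3 := h 1 0
    simp only [one_smul, zero_smul, zero_add, add_zero] at h1 h2 h3
    rw [add_comm v, h1, h2, h3]
    ring
  -- Pass from v to v - u along x - y, then from v - u to v + w along x - z. The v-dependent part
  -- left over is a difference of two values of F_y - F_z, which grow at the same rate along w and
  -- so cancel.
  have hdefect : ∀ v, F x (v + w) - F y (v + w) - (F x v - F y v) =
      (F y (v - u) - F z (v - u)) - (F y v - F z v)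
        + (F x (u + w) - F z (u + w)) - (F x u - F y u) - (F y w - F z w) := by
    intro v
    have h1 := hslope x y (v - u)
    have h2 := hslope x z (v - u)
    have h3 := hslope y z v
    rw [← hu, sub_add_cancel] at h1
    rw [hxz, show v - u + (u + w) = v + w by abel] at h2
    rw [hyz] at h3
    linarith
  have h1 := hdefect (v + b • w)
  have h2 := hdefect v
  have h3 := hw v b
  have h4 := hw (v - u) b
  rw [show v - u + b • w = v + b • w - u by abel] at h4
  linarith

theorem IsFinslerMetric.exists_sub_eq_clm [FiniteDimensional ℝ E]
    (hE : 3 ≤ Module.finrank ℝ E) {F : P → E → ℝ} (hF : IsFinslerMetric F)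
    (hU : ∀ (U : AffineSubspace ℝ P) [Nonempty U], IsAffineHyperplane U →
      IsMinkowskiRanders (inducedMetric F U)) (x y : P) :
    ∃ L : E →L[ℝ] ℝ, ∀ v, L v = F x v - F y v :=
  ⟨(AddMonoidHom.mk' (fun v => F x v - F y v) (hF.sub_map_add hE hU x y)).toRealLinearMap
    ((hF.continuous_apply x).sub (hF.continuous_apply y)), fun _ => rfl⟩

theorem IsMinkowskiNorm.isFinslerMetric_const {N : E → ℝ} (hN : IsMinkowskiNorm N)
    (hcont : Continuous N) : IsFinslerMetric (fun _ : P => N) where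
  continuous _ := hcont.comp continuous_snd
  contDiffOn _ := hN.contDiffOn.comp contDiff_snd.contDiffOn fun _ hp => hp
  isMinkowskiNorm _ := hN

theorem IsFinslerMetric.contDiff_apply {F : P → E → ℝ} (hF : IsFinslerMetric F) (o : P) (v : E) :
    ContDiff ℝ 2 (fun w : E => F (w +ᵥ o) v) := by
  -- F need not be smooth on the zero section, but it vanishes there.
  by_cases hv : v = 0
  · have h : ∀ x, F x v = 0 := fun x => ((hF.isMinkowskiNorm x).eq_zero_iff v).2 hv
    simp only [h]
    exact contDiff_const
  · rw [← contDiffOn_univ]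
    exact (hF.contDiffOn o).comp (f := fun w : E => (w, v)) (by fun_prop) fun _ _ => hv

theorem IsFinslerMetric.isMinkowskiRanders_of_hyperplanes [FiniteDimensional ℝ E]
    (hE : 3 ≤ Module.finrank ℝ E) {F : P → E → ℝ} (hF : IsFinslerMetric F)
    (hU : ∀ (U : AffineSubspace ℝ P) [Nonempty U], IsAffineHyperplane U →
      IsMinkowskiRanders (inducedMetric F U)) : IsMinkowskiRanders F := by
  obtain ⟨o⟩ : Nonempty P := AddTorsor.nonempty
  choose β hβ using fun x => hF.exists_sub_eq_clm hE hU x o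
  refine ⟨hF, fun _ => F o, β,
    (hF.isMinkowskiNorm o).isFinslerMetric_const (hF.continuous_apply o),
    fun _ _ _ => rfl, fun o' => ?_, fun x v => ?_⟩
  -- In finite dimension, regularity of a covector field can be tested on fixed vectors.
  · rw [contDiff_clm_apply_iff]
    intro v
    simp only [hβ]
    exact (hF.contDiff_apply o' v).sub contDiff_const
  · rw [hβ]
    ring

end Linearity

theorem mainTheorem6 {E P : Type*} [NormedAddCommGroup E] [NormedSpace ℝ E]
    [FiniteDimensional ℝ E] [AddTorsor E P] (n : ℕ) (hn : 3 ≤ n)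
    (hdim : Module.finrank ℝ E = n) (F : P → E → ℝ) (hF : IsFinslerMetric F) :
    IsMinkowskiRanders F ↔
      ∀ (U : AffineSubspace ℝ P) [Nonempty U], IsAffineHyperplane U →
        IsMinkowskiRanders (inducedMetric F U) :=
  ⟨fun h U _ _ => h.induced U,
    fun hU => hF.isMinkowskiRanders_of_hyperplanes (hdim ▸ hn) hU⟩
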